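/- Let $X$ be a real Hilbert space (with $X^*$ identified with $X$), let $\mathbb B$ be its closed unit ball, let $\Omega_1,\dots,\Omega_n\subset X$ be nonempty closed sets, let $d(x;\Omega)=\inf_{\omega\in\Omega}\|x-\omega\|$ and $\Pi(x;\Omega)=\{\omega\in\Omega : \|x-\omega\|=d(x;\Omega)\}$. The function $d(\cdot;\Omega)$ is called well posed at $\bar x\notin\Omega$ if for every sequence $x_k\to\bar x$ with $d(x_k;\Omega)\to d(\bar x;\Omega)$ there is a sequence of points $w_k\in\Pi(x_k;\Omega)$ that has a convergent subsequence. For $\varepsilon\ge 0$ and $x\in\Omega$ put $$\widehat N_\varepsilon(x;\Omega)=\Big\{v\in X : \limsup_{y\to x,\ y\in\Omega\setminus\{x\}}\frac{\langle v,y-x\rangle}{\|y-x\|}\le\varepsilon\Big\},$$ and $\widehat N_\varepsilon(x;\Omega)=\emptyset$ for $x\notin\Omega$. The limiting normal cone $N(\bar x;\Omega)$ is the set of weak limits of sequences $v_k\in\widehat N_{\varepsilon_k}(x_k;\Omega)$ with $\varepsilon_k\ge 0$, $\varepsilon_k\to0$ and $x_k\to\bar x$. For $\varphi:X\to(-\infty,\infty]$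 finite at $x$ let $$\widehat\partial_\varepsilon\varphi(x)=\Big\{v\in X : \liminf_{y\to x,\ y\ne x}\frac{\varphi(y)-\varphi(x)-\langle v,y-x\rangle}{\|y-x\|}\ge-\varepsilon\Big\};$$ the limiting subdifferential $\partial\varphi(\bar x)$ is the set of weak limits of sequences $v_k\in\widehat\partial_{\varepsilon_k}\varphi(x_k)$ with $\varepsilon_k\ge0$, $\varepsilon_k\to0$, $x_k\to\bar x$ and $\varphi(x_k)\to\varphi(\bar x)$. For $F\subset X$ let $T^F_\Omega(x)=\inf\{t\ge0 : \Omega\cap(x+tF)\ne\emptyset\}$, $\rho_F(x)=\inf\{t\ge0 : x\in tF\}$, $\Pi^F_\Omega(x)=(x+T^F_\Omega(x)F)\cap\Omega$ (when $T^F_\Omega(x)<\infty$). With $F=\mathbb B$ define, for $i=1,\dots,n$, $$A_i(x)=\bigcup_{\omega\in\Pi^F_{\Omega_i}(x)}\big[(-\partial\rho_F(\omega-x))\cap N(\omega;\Omega_i)\big].$$ Theorem. Let $\bar x\in X$ be a local minimizer of $D(x)=\sum_{i=1}^n d(x;\Omega_i)$ such that, for each $i$ with $\bar x\notin\Omega_i$,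 the function $d(\cdot;\Omega_i)$ is well posed at $\bar x$. Then $$0\in\sum_{i=1}^n A_i(\bar x),$$ and for every $i=1,\dots,n$ $$A_i(\bar x)=\begin{cases}\Big\{\dfrac{\bar x-\omega}{d(\bar x;\Omega_i)} : \omega\in\Pi(\bar x;\Omega_i)\Big\} & \text{if }\bar x\notin\Omega_i,\\[2ex] N(\bar x;\Omega_i)\cap\mathbb B & \text{if }\bar x\in\Omega_i.\end{cases}$$ -/

import Mathlib

open Filter Metric
open scoped Topology Pointwise

namespace FermatTorricelli

variable {X : Type*} [NormedAddCommGroup X] [InnerProductSpace ℝ X]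

/-! The dual of the Hilbert space `X` is identified with `X` by the Riesz isomorphism, so that
`⟨x*, x⟩` is `inner ℝ x* x` and sequential weak* convergence is sequential weak convergence. -/

/-- Weak convergence of a sequence. -/
def WeakTendsto (u : ℕ → X) (v : X) : Prop :=
  ∀ z : X, Tendsto (fun k => inner ℝ (u k) z) atTop (𝓝 (inner ℝ v z))

/-- The set of `ε`-normals to `Ω` at `x`, empty for `x ∉ Ω`. -/
def epsNormal (ε : ℝ) (x : X) (Ω : Set X) : Set X :=
  {v | x ∈ Ω ∧
    limsup (fun y : X => ((inner ℝ v (y - x) / ‖y - x‖ : ℝ) : EReal)) (𝓝[Ω \ {x}] x)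
      ≤ (ε : EReal)}

/-- The basic (limiting, Mordukhovich) normal cone `N(x; Ω)`. -/
def normalCone (x : X) (Ω : Set X) : Set X :=
  {v | ∃ (ε : ℕ → ℝ) (u : ℕ → X) (w : ℕ → X),
    (∀ k, 0 ≤ ε k) ∧ Tendsto ε atTop (𝓝 0) ∧ Tendsto u atTop (𝓝 x) ∧ WeakTendsto w v ∧
    ∀ k, w k ∈ epsNormal (ε k) (u k) Ω}

/-- The `ε`-subdifferential of an extended-real-valued function at `x`, empty where the function
is not finite. -/
def epsSubdiff (ε : ℝ) (φ : X → EReal) (x : X) : Set X :=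
  {v | φ x ≠ ⊤ ∧ φ x ≠ ⊥ ∧
    -(ε : EReal) ≤
      liminf (fun y : X => (φ y - φ x - ((inner ℝ v (y - x) : ℝ) : EReal)) / (‖y - x‖ : EReal))
        (𝓝[≠] x)}

/-- The basic (limiting, Mordukhovich) subdifferential of an extended-real-valued function at a
point where it is finite. -/
def basicSubdiff (φ : X → EReal) (x : X) : Set X :=
  {v | φ x ≠ ⊤ ∧ φ x ≠ ⊥ ∧ ∃ (ε : ℕ → ℝ) (u : ℕ → X) (w : ℕ → X),
    (∀ k, 0 ≤ ε k) ∧ Tendsto ε atTop (𝓝 0) ∧ Tendsto u atTop (𝓝 x) ∧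
    Tendsto (fun k => φ (u k)) atTop (𝓝 (φ x)) ∧ WeakTendsto w v ∧
    ∀ k, w k ∈ epsSubdiff (ε k) φ (u k)}

/-- The minimal time function `inf {t ≥ 0 | Ω ∩ (x + tF) ≠ ∅}`, with `inf ∅ = ∞`. -/
noncomputable def minimalTime (F Ω : Set X) (x : X) : EReal :=
  ⨅ t ∈ {t : ℝ | 0 ≤ t ∧ (Ω ∩ (x +ᵥ t • F)).Nonempty}, (t : EReal)

/-- The Minkowski gauge `inf {t ≥ 0 | x ∈ tF}`, with `inf ∅ = ∞`. -/
noncomputable def minkowskiGauge (F : Set X) (x : X) : EReal :=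
  ⨅ t ∈ {t : ℝ | 0 ≤ t ∧ x ∈ t • F}, (t : EReal)

/-- The generalized projection `(x + T F) ∩ Ω`, where `T < ∞` is the minimal time at `x`. -/
def genProj (F Ω : Set X) (x : X) : Set X :=
  {w | w ∈ Ω ∧ ∃ t : ℝ, minimalTime F Ω x = (t : EReal) ∧ w ∈ x +ᵥ t • F}

/-- The sets `A(x) = ⋃_{ω ∈ Π^F_Ω(x)} [-∂ρ_F(ω - x) ∩ N(ω; Ω)]`. -/
def optSet (F Ω : Set X) (x : X) : Set X :=
  ⋃ ω ∈ genProj F Ω x, (-basicSubdiff (minkowskiGauge F) (ω - x)) ∩ normalCone ω Ω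

/-- The metric projection `Π(x; Ω)`. -/
def proj (x : X) (Ω : Set X) : Set X :=
  {w | w ∈ Ω ∧ ‖x - w‖ = infDist x Ω}

/-- Well-posedness at `x` of the distance function to `Ω`. -/
def WellPosedDist (Ω : Set X) (x : X) : Prop :=
  ∀ u : ℕ → X, Tendsto u atTop (𝓝 x) →
    Tendsto (fun k => infDist (u k) Ω) atTop (𝓝 (infDist x Ω)) →
    ∃ w : ℕ → X, (∀ k, w k ∈ proj (u k) Ω) ∧
      ∃ (s : ℕ → ℕ) (z : X), StrictMono s ∧ Tendsto (w ∘ s) atTop (𝓝 z)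

end FermatTorricelli

/-! Choose a projection `a i` of `xbar` on each set. Then `(xbar, a)` minimizes `∑ ‖x - w i‖` over
`x` near `xbar` and `w i ∈ Ω i`: the sum of infima becomes a single constrained problem. Replace the
norm by the smooth `√(‖u‖² + η²)` and apply Ekeland's principle on this closed product. At the
nearby point obtained, let `v i` be the gradient of the smoothed norm at `x - w i`. Varying `w i`
alone makes `v i` an `ε`-normal to `Ω i`; varying `x` alone gives `‖∑ v i‖ ≤ ε`. As `ε → 0`, `x` and
`w` converge in norm to `xbar` and `a`, and bounded `v i` have weak limits `V i` along a common
subsequence. These sum to zero and lie in the required sets. Well-posedness serves only to make the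
projections nonempty.

The formulas follow from the description of the subdifferential of the norm at `p` by `‖v‖ ≤ 1` and
`⟨v, p⟩ = ‖p‖`: a single vector if `p ≠ 0`, the unit ball if `p = 0`. -/

/-- **Ekeland's variational principle** for a continuous function on a complete metric space. -/
theorem ekeland_variational_principle {E : Type*} [MetricSpace E] [CompleteSpace E] {f : E → ℝ}
    (hf : Continuous f) {a b : ℝ} (ha : 0 < a) {x₀ : E} (h₀ : ∀ y, f x₀ ≤ f y + a * b) :
    ∃ x, dist x₀ x ≤ b ∧ ∀ y, f x ≤ f y + a * dist x y := by
  -- `y ∈ T x` is Ekeland's partial order; the point sought is a minimal element.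
  set T : E → Set E := fun x => {y | f y + a * dist x y ≤ f x} with hT
  have hself : ∀ x, x ∈ T x := fun x => by simp [hT]
  have htrans : ∀ x y z, y ∈ T x → z ∈ T y → z ∈ T x := by
    intro x y z hy hz
    simp only [hT, Set.mem_ofPred_eq] at *
    nlinarith [dist_triangle x y z]
  have hclosed : ∀ x, IsClosed (T x) := fun x =>
    isClosed_le (hf.add (continuous_const.mul (continuous_const.dist continuous_id)))
      continuous_const
  have hstep : ∀ (x : E) (k : ℕ), ∃ z ∈ T x, ∀ y ∈ T x, f z ≤ f y + (1 / 2 : ℝ) ^ k := by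
    intro x k
    have hbdd : BddBelow (f '' T x) := by
      refine ⟨f x₀ - a * b, ?_⟩
      rintro _ ⟨y, -, rfl⟩
      linarith [h₀ y]
    obtain ⟨_, ⟨z, hz, rfl⟩, hlt⟩ := exists_lt_of_csInf_lt (Set.Nonempty.image f ⟨x, hself x⟩)
      (lt_add_of_pos_right (sInf (f '' T x)) (pow_pos (by norm_num : (0 : ℝ) < 1 / 2) k))
    exact ⟨z, hz, fun y hy => by linarith [csInf_le hbdd (Set.mem_image_of_mem f hy)]⟩
  choose g hgT hg using hstep
  let u : ℕ → E := fun k => Nat.rec x₀ (fun k x => g x k) k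
  have husucc : ∀ k, u (k + 1) = g (u k) k := fun _ => rfl
  have hchain : ∀ k m, k ≤ m → u m ∈ T (u k) := by
    intro k m hkm
    induction m, hkm using Nat.le_induction with
    | base => exact hself _
    | succ m _ ih => exact htrans _ _ _ ih (husucc m ▸ hgT _ _)
  -- Since `u (k + 1)` almost minimizes `f` on `T (u k)`, which contains `T (u (k + 1))`, the latter
  -- sets shrink to a point.
  have hsmall : ∀ k, ∀ y ∈ T (u (k + 1)), a * dist (u (k + 1)) y ≤ (1 / 2 : ℝ) ^ k := by
    intro k y hy
    have hyk : y ∈ T (u k) := htrans _ _ _ (hchain k (k + 1) k.le_succ) hy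
    have hle := hg (u k) k y hyk
    rw [← husucc] at hle
    simp only [hT, Set.mem_ofPred_eq] at hy
    linarith
  have hlim : Tendsto (fun k : ℕ => a⁻¹ * (1 / 2 : ℝ) ^ k) atTop (𝓝 0) := by
    simpa using (tendsto_pow_atTop_nhds_zero_of_lt_one (r := (1 / 2 : ℝ)) (by norm_num)
      (by norm_num)).const_mul a⁻¹
  have hdist : ∀ k, ∀ y ∈ T (u (k + 1)), dist (u (k + 1)) y ≤ a⁻¹ * (1 / 2 : ℝ) ^ k := by
    intro k y hy
    rw [inv_mul_eq_div, le_div_iff₀' ha]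
    exact hsmall k y hy
  have hcauchy : CauchySeq fun k => u (k + 1) :=
    cauchySeq_of_le_tendsto_0' _
      (fun k m hkm => hdist k _ (hchain (k + 1) (m + 1) (by omega))) hlim
  obtain ⟨x, hx⟩ := cauchySeq_tendsto_of_complete hcauchy
  have hxT : ∀ k, x ∈ T (u k) := fun k =>
    (hclosed (u k)).mem_of_tendsto hx
      (eventually_atTop.2 ⟨k, fun m hm => hchain k (m + 1) (by omega)⟩)
  refine ⟨x, ?_, fun y => ?_⟩
  · have h1 : f x + a * dist x₀ x ≤ f x₀ := hxT 0
    exact le_of_mul_le_mul_left (by linarith [h₀ x]) ha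
  · by_contra! hlt
    have hy : y ∈ T x := hlt.le
    have hxy : x = y := by
      have h2 : Tendsto (fun k => dist (u (k + 1)) y) atTop (𝓝 0) :=
        squeeze_zero (fun _ => dist_nonneg)
          (fun k => hdist k y (htrans _ _ _ (hxT (k + 1)) hy)) hlim
      exact tendsto_nhds_unique hx (tendsto_iff_dist_tendsto_zero.2 h2)
    subst hxy
    simp at hlt

namespace FermatTorricelli

variable {X : Type*} [NormedAddCommGroup X] [InnerProductSpace ℝ X]

/-! ### Weak sequential compactness -/

/-- Bounded sequences in a separable Hilbert space have weakly convergent subsequences. -/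
theorem exists_weakTendsto_subseq_of_separable [CompleteSpace X]
    [TopologicalSpace.SeparableSpace X] (u : ℕ → X) {C : ℝ} (hu : ∀ k, ‖u k‖ ≤ C) :
    ∃ (v : X) (s : ℕ → ℕ), StrictMono s ∧ WeakTendsto (u ∘ s) v := by
  let U : ℕ → WeakDual ℝ X := fun k => StrongDual.toWeakDual (InnerProductSpace.toDual ℝ X (u k))
  have hU : ∀ k, U k ∈ WeakDual.toStrongDual ⁻¹' closedBall (0 : StrongDual ℝ X) C := by
    intro k
    have hk : ‖InnerProductSpace.toDual ℝ X (u k)‖ ≤ C := by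
      rw [LinearIsometryEquiv.norm_map]
      exact hu k
    exact (mem_closedBall_zero_iff (E := StrongDual ℝ X)).2 hk
  obtain ⟨V, -, s, hs, hV⟩ := WeakDual.isSeqCompact_closedBall ℝ X 0 C hU
  refine ⟨(InnerProductSpace.toDual ℝ X).symm (WeakDual.toStrongDual V), s, hs, fun z => ?_⟩
  rw [InnerProductSpace.toDual_symm_apply]
  exact ((WeakDual.eval_continuous (𝕜 := ℝ) (E := X) z).tendsto V).comp hV

/-- Bounded sequences in a Hilbert space have weakly convergent subsequences. -/
theorem exists_weakTendsto_subseq [CompleteSpace X] (u : ℕ → X) {C : ℝ} (hu : ∀ k, ‖u k‖ ≤ C) :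
    ∃ (v : X) (s : ℕ → ℕ), StrictMono s ∧ WeakTendsto (u ∘ s) v := by
  let Y : Submodule ℝ X := (Submodule.span ℝ (Set.range u)).topologicalClosure
  have huY : ∀ k, u k ∈ Y := fun k =>
    Submodule.le_topologicalClosure _ (Submodule.subset_span ⟨k, rfl⟩)
  have : TopologicalSpace.SeparableSpace Y := by
    have hsep : TopologicalSpace.IsSeparable (Y : Set X) := by
      rw [Submodule.topologicalClosure_coe]
      exact ((Set.countable_range u).isSeparable.span (R := ℝ)).closure
    exact hsep.separableSpace
  have : CompleteSpace Y := (Submodule.isClosed_topologicalClosure _).completeSpace_coe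
  obtain ⟨v, s, hs, hv⟩ :=
    exists_weakTendsto_subseq_of_separable (fun k => (⟨u k, huY k⟩ : Y)) (C := C) hu
  refine ⟨v, s, hs, fun z => ?_⟩
  -- Testing against `z` amounts to testing against its projection on the separable subspace `Y`.
  have key : ∀ y : Y, inner ℝ y (Y.orthogonalProjectionOnto z) = inner ℝ (y : X) z :=
    fun y => Submodule.inner_orthogonalProjectionOnto_eq_of_mem_left y z
  simpa only [key, Function.comp_apply] using hv (Y.orthogonalProjectionOnto z)

/-- Finitely many bounded sequences in a Hilbert space converge weakly along a common
subsequence. -/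
theorem exists_weakTendsto_subseq_pi [CompleteSpace X] {ι : Type*} [Fintype ι] (u : ℕ → ι → X)
    {C : ℝ} (hu : ∀ k i, ‖u k i‖ ≤ C) :
    ∃ (v : ι → X) (s : ℕ → ℕ), StrictMono s ∧ ∀ i, WeakTendsto (fun k => u (s k) i) (v i) := by
  classical
  have hbound : ∀ k, ‖(WithLp.toLp 2 (u k) : PiLp 2 fun _ : ι => X)‖ ≤
      Real.sqrt (∑ _i : ι, C ^ 2) := by
    intro k
    rw [PiLp.norm_eq_of_L2]
    refine Real.sqrt_le_sqrt (Finset.sum_le_sum fun i _ => ?_)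
    exact pow_le_pow_left₀ (norm_nonneg _) (hu k i) 2
  obtain ⟨v, s, hs, hv⟩ := exists_weakTendsto_subseq _ hbound
  refine ⟨v, s, hs, fun i z => ?_⟩
  have hinner : ∀ w : PiLp 2 fun _ : ι => X,
      inner ℝ w (WithLp.toLp 2 (Pi.single i z) : PiLp 2 fun _ : ι => X) = inner ℝ (w i) z := by
    intro w
    rw [PiLp.inner_apply, Finset.sum_eq_single i]
    · simp
    · intro j _ hj
      simp [Pi.single_eq_of_ne hj]
    · simp
  simpa only [hinner, Function.comp_apply] using hv (WithLp.toLp 2 (Pi.single i z))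

/-! ### Gauge, minimal time and projection for the unit ball -/

theorem mem_smul_closedUnitBall {t : ℝ} (ht : 0 ≤ t) (x : X) :
    x ∈ t • closedBall (0 : X) 1 ↔ ‖x‖ ≤ t := by
  rw [smul_unitClosedBall_of_nonneg ht, mem_closedBall_zero_iff]

theorem mem_vadd_smul_closedUnitBall {t : ℝ} (ht : 0 ≤ t) (x y : X) :
    y ∈ x +ᵥ t • closedBall (0 : X) 1 ↔ ‖x - y‖ ≤ t := by
  rw [Set.mem_vadd_set_iff_neg_vadd_mem, mem_smul_closedUnitBall ht, vadd_eq_add,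
    neg_add_eq_sub, norm_sub_rev]

/-- The Minkowski gauge of the closed unit ball is the norm. -/
theorem minkowskiGauge_closedUnitBall (x : X) :
    minkowskiGauge (closedBall (0 : X) 1) x = (‖x‖ : EReal) := by
  refine le_antisymm ?_ ?_
  · exact iInf₂_le (f := fun (t : ℝ) _ => (t : EReal)) ‖x‖
      ⟨norm_nonneg x, (mem_smul_closedUnitBall (norm_nonneg x) x).2 le_rfl⟩
  · exact le_iInf₂ fun t ht => EReal.coe_le_coe_iff.2 ((mem_smul_closedUnitBall ht.1 x).1 ht.2)

/-- The minimal time function of the closed unit ball is the distance function. -/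
theorem minimalTime_closedUnitBall {Ω : Set X} (hΩ : Ω.Nonempty) (x : X) :
    minimalTime (closedBall (0 : X) 1) Ω x = (infDist x Ω : EReal) := by
  refine le_antisymm ?_ ?_
  -- The distance need not be attained, so only radii `r` above it are admissible a priori.
  · refine EReal.le_of_forall_lt_iff_le.1 fun r hr => ?_
    obtain ⟨y, hy, hlt⟩ := (infDist_lt_iff hΩ).1 (EReal.coe_lt_coe_iff.1 hr)
    have hr0 : 0 ≤ r := dist_nonneg.trans hlt.le
    refine iInf₂_le (f := fun (t : ℝ) _ => (t : EReal)) r ⟨hr0, y, hy, ?_⟩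
    rw [mem_vadd_smul_closedUnitBall hr0, ← dist_eq_norm]
    exact hlt.le
  · refine le_iInf₂ fun t ht => EReal.coe_le_coe_iff.2 ?_
    obtain ⟨y, hy, hyt⟩ := ht.2
    rw [mem_vadd_smul_closedUnitBall ht.1, ← dist_eq_norm] at hyt
    exact (infDist_le_dist_of_mem hy).trans hyt

/-- The generalized projection for the closed unit ball is the metric projection. -/
theorem genProj_closedUnitBall {Ω : Set X} (hΩ : Ω.Nonempty) (x : X) :
    genProj (closedBall (0 : X) 1) Ω x = proj x Ω := by
  ext w
  simp only [genProj, proj, Set.mem_ofPred_eq, minimalTime_closedUnitBall hΩ,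
    EReal.coe_eq_coe_iff]
  refine and_congr_right fun hw => ?_
  have hle : infDist x Ω ≤ ‖x - w‖ := by
    rw [← dist_eq_norm]
    exact infDist_le_dist_of_mem hw
  constructor
  · rintro ⟨t, rfl, ht⟩
    exact le_antisymm ((mem_vadd_smul_closedUnitBall infDist_nonneg x w).1 ht) hle
  · exact fun h => ⟨_, rfl, (mem_vadd_smul_closedUnitBall infDist_nonneg x w).2 h.le⟩

/-! ### Normals and subgradients of the norm -/

/-- The quadratic term is `o(‖y - x‖)`, so it does not affect the upper limit. -/
theorem mem_epsNormal_of_le {ε C : ℝ} {x v : X} {Ω : Set X} (hx : x ∈ Ω)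
    (h : ∀ y ∈ Ω, inner ℝ v (y - x) ≤ ε * ‖y - x‖ + C * ‖y - x‖ ^ 2) :
    v ∈ epsNormal ε x Ω := by
  refine ⟨hx, (limsup_le_iff (by isBoundedDefault) (by isBoundedDefault)).2 fun b hb => ?_⟩
  have hlim : Tendsto (fun y : X => ((ε + C * ‖y - x‖ : ℝ) : EReal)) (𝓝[Ω \ {x}] x)
      (𝓝 (ε : EReal)) := by
    refine (continuous_coe_real_ereal.tendsto ε).comp ?_
    have hc : Continuous fun y : X => ε + C * ‖y - x‖ := by fun_prop
    simpa using (hc.tendsto x).mono_left nhdsWithin_le_nhds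
  filter_upwards [hlim.eventually_lt_const hb, self_mem_nhdsWithin] with y hy hyΩ
  have hpos : 0 < ‖y - x‖ := norm_pos_iff.2 (sub_ne_zero.2 hyΩ.2)
  refine lt_of_le_of_lt (EReal.coe_le_coe_iff.2 ?_) hy
  rw [div_le_iff₀ hpos]
  linarith [h y hyΩ.1]

/-- The convexity of the norm turns the local inequality defining an `ε`-subgradient into a
global one. -/
theorem inner_le_of_mem_epsSubdiff_norm {ε : ℝ} {p w : X}
    (hw : w ∈ epsSubdiff ε (minkowskiGauge (closedBall (0 : X) 1)) p) (h : X) :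
    inner ℝ w h ≤ ‖p + h‖ - ‖p‖ + ε * ‖h‖ := by
  rcases eq_or_ne h 0 with rfl | hh
  · simp
  have hpos : 0 < ‖h‖ := norm_pos_iff.2 hh
  have hlim := hw.2.2
  simp only [minkowskiGauge_closedUnitBall] at hlim
  have hle : ∀ r : ℝ, ε < r → inner ℝ w h ≤ ‖p + h‖ - ‖p‖ + r * ‖h‖ := by
    intro r hr
    have hev : ∀ᶠ y in 𝓝[≠] p, ((-r : ℝ) : EReal) <
        ((‖y‖ : EReal) - (‖p‖ : EReal) - ((inner ℝ w (y - p) : ℝ) : EReal)) / (‖y - p‖ : EReal) :=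
      eventually_lt_of_lt_liminf (lt_of_lt_of_le (by
        rw [← EReal.coe_neg]
        exact EReal.coe_lt_coe_iff.2 (by linarith)) hlim)
    have hpath : Tendsto (fun t : ℝ => p + t • h) (𝓝[>] 0) (𝓝[≠] p) := by
      refine tendsto_nhdsWithin_iff.2 ⟨?_, ?_⟩
      · have hc : Continuous fun t : ℝ => p + t • h := by fun_prop
        simpa using (hc.tendsto 0).mono_left nhdsWithin_le_nhds
      · filter_upwards [self_mem_nhdsWithin] with t ht
        simpa using ⟨(ne_of_gt ht : t ≠ 0), hh⟩
    obtain ⟨t, hev_t, ht⟩ := ((hpath.eventually hev).and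
      (Ioo_mem_nhdsGT (zero_lt_one' ℝ))).exists
    rw [← EReal.coe_sub, ← EReal.coe_sub, ← EReal.coe_div, EReal.coe_lt_coe_iff,
      add_sub_cancel_left, inner_smul_right, norm_smul, Real.norm_of_nonneg ht.1.le,
      lt_div_iff₀ (mul_pos ht.1 hpos)] at hev_t
    have hconv : ‖p + t • h‖ ≤ (1 - t) * ‖p‖ + t * ‖p + h‖ := by
      have heq : p + t • h = (1 - t) • p + t • (p + h) := by module
      rw [heq]
      refine (norm_add_le _ _).trans_eq ?_
      rw [norm_smul, norm_smul, Real.norm_of_nonneg ht.1.le,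
        Real.norm_of_nonneg (by linarith [ht.2])]
    have hmul : t * inner ℝ w h ≤ t * (‖p + h‖ - ‖p‖ + r * ‖h‖) := by nlinarith
    exact le_of_mul_le_mul_left hmul ht.1
  have hcont : Tendsto (fun r : ℝ => ‖p + h‖ - ‖p‖ + r * ‖h‖) (𝓝[>] ε)
      (𝓝 (‖p + h‖ - ‖p‖ + ε * ‖h‖)) := by
    have hc : Continuous fun r : ℝ => ‖p + h‖ - ‖p‖ + r * ‖h‖ := by fun_prop
    exact (hc.tendsto ε).mono_left nhdsWithin_le_nhds
  exact ge_of_tendsto hcont (by filter_upwards [self_mem_nhdsWithin] with r hr using hle r hr)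

/-- The basic subdifferential of the norm is its subdifferential in the sense of convex
analysis. -/
theorem mem_basicSubdiff_norm_iff {p v : X} :
    v ∈ basicSubdiff (minkowskiGauge (closedBall (0 : X) 1)) p ↔
      ‖v‖ ≤ 1 ∧ inner ℝ v p = ‖p‖ := by
  constructor
  · rintro ⟨-, -, ε, u, w, -, hε, hu, -, hw, hmem⟩
    have key : ∀ h : X, inner ℝ v h ≤ ‖p + h‖ - ‖p‖ := by
      intro h
      have hr : Tendsto (fun k => ‖u k + h‖ - ‖u k‖ + ε k * ‖h‖) atTop
          (𝓝 (‖p + h‖ - ‖p‖ + 0 * ‖h‖)) :=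
        (((hu.add_const h).norm).sub hu.norm).add (hε.mul_const _)
      simpa using le_of_tendsto_of_tendsto' (hw h) hr
        fun k => inner_le_of_mem_epsSubdiff_norm (hmem k) h
    constructor
    -- The direction `h = v` bounds the norm; below, `h = p` and `h = -p` give the two halves of the
    -- equality.
    · have h1 : inner ℝ v v ≤ ‖v‖ := by linarith [key v, norm_add_le p v]
      rw [real_inner_self_eq_norm_sq] at h1
      nlinarith [norm_nonneg v]
    · have h1 := key p
      have h2 := key (-p)
      rw [← two_smul ℝ p, norm_smul] at h1
      simp only [add_neg_cancel, norm_zero, inner_neg_right, Real.norm_ofNat] at h1 h2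
      linarith
  · rintro ⟨hv, hvp⟩
    have htop : minkowskiGauge (closedBall (0 : X) 1) p ≠ ⊤ := by
      simp [minkowskiGauge_closedUnitBall]
    have hbot : minkowskiGauge (closedBall (0 : X) 1) p ≠ ⊥ := by
      simp [minkowskiGauge_closedUnitBall]
    refine ⟨htop, hbot, fun _ => 0, fun _ => p, fun _ => v, fun _ => le_rfl, tendsto_const_nhds,
      tendsto_const_nhds, tendsto_const_nhds, fun _ => tendsto_const_nhds,
      fun _ => ⟨htop, hbot, ?_⟩⟩
    refine le_liminf_of_le (by isBoundedDefault) (Eventually.of_forall fun y => ?_)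
    rw [minkowskiGauge_closedUnitBall, minkowskiGauge_closedUnitBall, ← EReal.coe_sub,
      ← EReal.coe_sub, ← EReal.coe_div, ← EReal.coe_neg, EReal.coe_le_coe_iff, neg_zero,
      inner_sub_right, hvp]
    refine div_nonneg ?_ (norm_nonneg _)
    have h1 := real_inner_le_norm v y
    nlinarith [norm_nonneg y]

/-- The basic normal cone contains the proximal normals. -/
theorem smul_sub_mem_normalCone_of_mem_proj {x w : X} {Ω : Set X} (hw : w ∈ proj x Ω) {c : ℝ}
    (hc : 0 ≤ c) : c • (x - w) ∈ normalCone w Ω := by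
  refine ⟨fun _ => 0, fun _ => w, fun _ => c • (x - w), fun _ => le_rfl, tendsto_const_nhds,
    tendsto_const_nhds, fun _ => tendsto_const_nhds,
    fun _ => mem_epsNormal_of_le (C := c / 2) hw.1 fun y hy => ?_⟩
  have h1 : ‖x - w‖ ≤ ‖(x - w) - (y - w)‖ := by
    rw [hw.2, sub_sub_sub_cancel_right, ← dist_eq_norm]
    exact infDist_le_dist_of_mem hy
  have h2 : ‖x - w‖ ^ 2 ≤ ‖(x - w) - (y - w)‖ ^ 2 := pow_le_pow_left₀ (norm_nonneg _) h1 2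
  rw [norm_sub_sq_real (x - w)] at h2
  rw [real_inner_smul_left]
  nlinarith

/-! ### Explicit form of the optimality sets -/

theorem mem_optSet_closedUnitBall {Ω : Set X} (hΩ : Ω.Nonempty) {x v : X} :
    v ∈ optSet (closedBall (0 : X) 1) Ω x ↔
      ∃ w ∈ proj x Ω, ‖v‖ ≤ 1 ∧ inner ℝ v (x - w) = ‖x - w‖ ∧ v ∈ normalCone w Ω := by
  simp only [optSet, genProj_closedUnitBall hΩ, Set.mem_iUnion, Set.mem_inter_iff, Set.mem_neg,
    mem_basicSubdiff_norm_iff, norm_neg, inner_neg_left, exists_prop, and_assoc]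
  simp only [← inner_neg_right, neg_sub, norm_sub_rev _ x]

/-- Equality in the Cauchy-Schwarz inequality for a vector of the unit ball. -/
theorem eq_inv_norm_smul_of_inner_eq_norm {v p : X} (hp : p ≠ 0) (hv : ‖v‖ ≤ 1)
    (h : inner ℝ v p = ‖p‖) : v = ‖p‖⁻¹ • p := by
  have hpos : 0 < ‖p‖ := norm_pos_iff.2 hp
  have h1 : ‖v - ‖p‖⁻¹ • p‖ ^ 2 ≤ 0 := by
    rw [norm_sub_sq_real, inner_smul_right, h, norm_smul, norm_inv, norm_norm,
      inv_mul_cancel₀ hpos.ne']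
    nlinarith [norm_nonneg v]
  exact sub_eq_zero.1 (norm_eq_zero.1 (pow_eq_zero_iff two_ne_zero |>.1
    (le_antisymm h1 (sq_nonneg _))))

/-- Equality in Cauchy-Schwarz leaves one vector per projection, and it is a proximal normal, so the
normal cone imposes nothing more. -/
theorem optSet_closedUnitBall_of_notMem {Ω : Set X} (hΩ : Ω.Nonempty) (hcl : IsClosed Ω) {x : X}
    (hx : x ∉ Ω) :
    optSet (closedBall (0 : X) 1) Ω x =
      (fun w : X => (infDist x Ω)⁻¹ • (x - w)) '' proj x Ω := by
  have hd : 0 < infDist x Ω := (hcl.notMem_iff_infDist_pos hΩ).1 hx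
  ext v
  rw [mem_optSet_closedUnitBall hΩ]
  constructor
  · rintro ⟨w, hw, hv, hin, -⟩
    refine ⟨w, hw, ?_⟩
    have hne : x - w ≠ 0 := norm_pos_iff.1 (hw.2 ▸ hd)
    simpa only [hw.2] using (eq_inv_norm_smul_of_inner_eq_norm hne hv hin).symm
  · rintro ⟨w, hw, rfl⟩
    refine ⟨w, hw, ?_, ?_, smul_sub_mem_normalCone_of_mem_proj hw (inv_nonneg.2 hd.le)⟩
    · rw [norm_smul, hw.2, norm_inv, Real.norm_of_nonneg hd.le, inv_mul_cancel₀ hd.ne']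
    · rw [real_inner_smul_left, real_inner_self_eq_norm_sq, hw.2]
      field_simp

theorem optSet_closedUnitBall_of_mem {Ω : Set X} {x : X} (hx : x ∈ Ω) :
    optSet (closedBall (0 : X) 1) Ω x = normalCone x Ω ∩ closedBall (0 : X) 1 := by
  have hproj : ∀ w, w ∈ proj x Ω ↔ w = x := by
    intro w
    simp only [proj, Set.mem_ofPred_eq, infDist_zero_of_mem hx, norm_eq_zero, sub_eq_zero]
    exact ⟨fun h => h.2.symm, fun h => ⟨h ▸ hx, h.symm⟩⟩
  ext v
  rw [mem_optSet_closedUnitBall ⟨x, hx⟩]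
  simp [hproj, and_comm]

/-! ### Approximate stationarity -/

/-- A quadratic upper estimate for the smooth approximation `√(‖u‖² + η²)` of the norm. -/
theorem sqrt_norm_add_sq_le {η : ℝ} (hη : 0 < η) (u h : X) :
    √(‖u + h‖ ^ 2 + η ^ 2) ≤ √(‖u‖ ^ 2 + η ^ 2) +
      inner ℝ ((√(‖u‖ ^ 2 + η ^ 2))⁻¹ • u) h + η⁻¹ * ‖h‖ ^ 2 := by
  set s := √(‖u‖ ^ 2 + η ^ 2) with hs
  have hs2 : s ^ 2 = ‖u‖ ^ 2 + η ^ 2 := Real.sq_sqrt (by positivity)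
  have hsη : η ≤ s := Real.le_sqrt_of_sq_le (by nlinarith [sq_nonneg ‖u‖])
  have hs0 : 0 < s := hη.trans_le hsη
  have h1 : √(‖u + h‖ ^ 2 + η ^ 2) ≤ s + s⁻¹ * inner ℝ u h + s⁻¹ * ‖h‖ ^ 2 / 2 := by
    set t := √(‖u + h‖ ^ 2 + η ^ 2) with ht
    have ht2 : t ^ 2 = ‖u + h‖ ^ 2 + η ^ 2 := Real.sq_sqrt (by positivity)
    rw [norm_add_sq_real] at ht2
    -- This is `2ts ≤ t² + s²` with `t²` expanded.
    have h3 : t * s ≤ s ^ 2 + inner ℝ u h + ‖h‖ ^ 2 / 2 := by nlinarith [sq_nonneg (t - s)]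
    rw [← mul_le_mul_iff_left₀ hs0]
    refine h3.trans_eq ?_
    field_simp
  have h2 : s⁻¹ * ‖h‖ ^ 2 / 2 ≤ η⁻¹ * ‖h‖ ^ 2 := by
    have h3 : s⁻¹ * ‖h‖ ^ 2 ≤ η⁻¹ * ‖h‖ ^ 2 :=
      mul_le_mul_of_nonneg_right (inv_anti₀ hη hsη) (sq_nonneg _)
    have h4 : 0 ≤ s⁻¹ * ‖h‖ ^ 2 := by positivity
    linarith
  rw [real_inner_smul_left]
  linarith

/-- Test with `z = -tV`, divide by `t‖V‖` and let `t ↓ 0`. -/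
theorem norm_le_of_forall_inner_nonneg {V : X} {ε C r : ℝ} (hε : 0 ≤ ε) (hr : 0 < r)
    (h : ∀ z : X, ‖z‖ ≤ r → 0 ≤ inner ℝ V z + ε * ‖z‖ + C * ‖z‖ ^ 2) : ‖V‖ ≤ ε := by
  rcases eq_or_ne V 0 with rfl | hV
  · simpa using hε
  have hpos : 0 < ‖V‖ := norm_pos_iff.2 hV
  have hlim : Tendsto (fun t : ℝ => ε + C * (t * ‖V‖)) (𝓝[>] 0) (𝓝 ε) := by
    have hc : Continuous fun t : ℝ => ε + C * (t * ‖V‖) := by fun_prop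
    simpa using (hc.tendsto 0).mono_left nhdsWithin_le_nhds
  refine ge_of_tendsto hlim ?_
  filter_upwards [Ioo_mem_nhdsGT (div_pos hr hpos)] with t ht
  have htV : ‖(-t) • V‖ = t * ‖V‖ := by rw [norm_smul, norm_neg, Real.norm_of_nonneg ht.1.le]
  have h1 := h ((-t) • V) (by
    rw [htV]
    exact ((lt_div_iff₀ hpos).1 ht.2).le)
  rw [htV, inner_smul_right, real_inner_self_eq_norm_sq] at h1
  have h2 : t * ‖V‖ * ‖V‖ ≤ t * ‖V‖ * (ε + C * (t * ‖V‖)) := by linarith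
  exact le_of_mul_le_mul_left h2 (mul_pos ht.1 hpos)

/-- Approximate stationarity: at a local minimizer of a sum of distances there are almost normal
vectors to the sets, at points close to the projections, whose sum is almost zero. -/
theorem exists_epsNormal_of_isLocalMin [CompleteSpace X] {ι : Type*} [Fintype ι] {Ω : ι → Set X}
    (hcl : ∀ i, IsClosed (Ω i)) {xbar : X} {a : ι → X} (ha : ∀ i, a i ∈ Ω i) {r : ℝ}
    (hmin : ∀ x ∈ closedBall xbar r, ∀ w : ι → X, (∀ i, w i ∈ Ω i) →
      ∑ i, ‖xbar - a i‖ ≤ ∑ i, ‖x - w i‖)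
    {ε : ℝ} (hε : 0 < ε) (hεr : ε < r) (hε1 : ε ≤ 1) :
    ∃ (x : X) (w v : ι → X), ‖x - xbar‖ ≤ ε ∧ (∀ i, ‖w i - a i‖ ≤ ε) ∧
      (∀ i, v i ∈ epsNormal ε (w i) (Ω i)) ∧ (∀ i, ‖v i‖ ≤ 1) ∧
      (∀ i, ‖x - w i‖ - ε ≤ inner ℝ (v i) (x - w i)) ∧ ‖∑ i, v i‖ ≤ ε := by
  classical
  let n : ℝ := (Fintype.card ι : ℝ)
  have hn0 : 0 ≤ n := Nat.cast_nonneg _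
  -- Smoothing costs at most `n * η ≤ ε * ε`, which is what Ekeland's principle with `a = b = ε`
  -- tolerates; `n + 1` covers an empty index set.
  set η : ℝ := ε * ε / (n + 1) with hη
  have hη0 : 0 < η := by positivity
  have hnη : n * η ≤ ε * ε := by
    rw [hη, ← mul_div_assoc, div_le_iff₀ (by positivity)]
    nlinarith [mul_pos hε hε]
  have hηε : η ≤ ε := by
    rw [hη, div_le_iff₀ (by positivity)]
    nlinarith
  let φ : X → ℝ := fun u => √(‖u‖ ^ 2 + η ^ 2)
  have hφ : ∀ u, ‖u‖ ≤ φ u := fun u => Real.le_sqrt_of_sq_le (by nlinarith [sq_nonneg η])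
  have hφη : ∀ u, η ≤ φ u := fun u => Real.le_sqrt_of_sq_le (by nlinarith [sq_nonneg ‖u‖])
  have hφ' : ∀ u, φ u ≤ ‖u‖ + η := fun u =>
    Real.sqrt_le_iff.2 ⟨by positivity, by nlinarith [norm_nonneg u]⟩
  have hφsq : ∀ u, φ u ^ 2 = ‖u‖ ^ 2 + η ^ 2 := fun u => Real.sq_sqrt (by positivity)
  have hφc : Continuous φ := by fun_prop
  let S : Set (X × (ι → X)) := closedBall xbar r ×ˢ Set.univ.pi Ω
  have hS : IsClosed S := isClosed_closedBall.prod (isClosed_set_pi fun i _ => hcl i)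
  have : CompleteSpace S := hS.completeSpace_coe
  let f : S → ℝ := fun q => ∑ i, φ (q.1.1 - q.1.2 i)
  have hf : Continuous f := by fun_prop
  let q₀ : S := ⟨(xbar, a), mem_closedBall_self (hε.trans hεr).le, fun i _ => ha i⟩
  have h₀ : ∀ q, f q₀ ≤ f q + ε * ε := by
    intro q
    have h1 : f q₀ ≤ ∑ i, ‖xbar - a i‖ + n * η := by
      refine (Finset.sum_le_sum fun i _ => hφ' (xbar - a i)).trans_eq ?_
      rw [Finset.sum_add_distrib, Finset.sum_const, nsmul_eq_mul, Finset.card_univ]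
    have h2 : ∑ i, ‖q.1.1 - q.1.2 i‖ ≤ f q := Finset.sum_le_sum fun i _ => hφ _
    have h3 := hmin q.1.1 q.2.1 q.1.2 fun i => q.2.2 i trivial
    linarith
  obtain ⟨⟨⟨x, w⟩, hxS, hwS⟩, hdist, hek⟩ := ekeland_variational_principle hf hε h₀
  have hdist' : dist xbar x ≤ ε ∧ dist a w ≤ ε := max_le_iff.1 hdist
  have hw : ∀ i, w i ∈ Ω i := fun i => hwS i trivial
  have hxr : ‖x - xbar‖ ≤ ε := by
    rw [← dist_eq_norm, dist_comm]
    exact hdist'.1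
  have hek' : ∀ (y : X) (z : ι → X), ‖y - xbar‖ ≤ r → (∀ i, z i ∈ Ω i) →
      ∑ i, φ (x - w i) ≤ ∑ i, φ (y - z i) + ε * max (dist x y) (dist w z) := fun y z hy hz =>
    hek ⟨(y, z), mem_closedBall_iff_norm.2 hy, fun i _ => hz i⟩
  let v : ι → X := fun i => (φ (x - w i))⁻¹ • (x - w i)
  have hquad : ∀ i h, φ (x - w i + h) ≤ φ (x - w i) + inner ℝ (v i) h + η⁻¹ * ‖h‖ ^ 2 :=
    fun i h => sqrt_norm_add_sq_le hη0 _ h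
  refine ⟨x, w, v, hxr, fun i => ?_, fun i => ?_, fun i => ?_, fun i => ?_, ?_⟩
  · rw [← dist_eq_norm, dist_comm]
    exact (dist_le_pi_dist a w i).trans hdist'.2
  · refine mem_epsNormal_of_le (C := η⁻¹) (hw i) fun y hy => ?_
    have h1 := hek' x (Function.update w i y) (hxr.trans hεr.le) (fun j => by
      rcases eq_or_ne j i with rfl | hj
      · simpa using hy
      · simpa [hj] using hw j)
    -- In the sup metric, moving one coordinate costs only its own displacement.
    have h2 : max (dist x x) (dist w (Function.update w i y)) ≤ ‖y - w i‖ := by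
      rw [dist_self]
      refine max_le (norm_nonneg _) ((dist_pi_le_iff (norm_nonneg _)).2 fun j => ?_)
      rcases eq_or_ne j i with rfl | hj
      · rw [Function.update_self, dist_comm, dist_eq_norm]
      · simp [hj]
    have h3 : ∑ j, φ (x - Function.update w i y j) - ∑ j, φ (x - w j) =
        φ (x - y) - φ (x - w i) := by
      rw [← Finset.sum_sub_distrib, Finset.sum_eq_single i]
      · simp
      · intro j _ hj
        simp [hj]
      · simp
    have h4 := hquad i (-(y - w i))
    rw [norm_neg, inner_neg_right, show x - w i + -(y - w i) = x - y by abel] at h4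
    have h5 := mul_le_mul_of_nonneg_left h2 hε.le
    linarith
  · have hpos : 0 < φ (x - w i) := hη0.trans_le (hφη _)
    rw [norm_smul, norm_inv, Real.norm_of_nonneg hpos.le, inv_mul_le_iff₀ hpos, mul_one]
    exact hφ _
  · have hpos : 0 < φ (x - w i) := hη0.trans_le (hφη _)
    rw [real_inner_smul_left, real_inner_self_eq_norm_sq, inv_mul_eq_div, le_div_iff₀ hpos]
    -- With `u = x - w i`: `‖u‖² / φ u = φ u - η² / φ u ≥ φ u - η ≥ ‖u‖ - ε`.
    nlinarith [hφ (x - w i), hφη (x - w i), hφsq (x - w i)]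
  -- The radius `r - ε` keeps `x + z` in the ball where minimality holds.
  · refine norm_le_of_forall_inner_nonneg (C := n * η⁻¹) hε.le (sub_pos.2 hεr) fun z hz => ?_
    have h1 := hek' (x + z) w (by
      have h2 : x + z - xbar = (x - xbar) + z := by abel
      rw [h2]
      linarith [norm_add_le (x - xbar) z]) hw
    have h2 : max (dist x (x + z)) (dist w w) = ‖z‖ := by simp [dist_eq_norm]
    have h3 : ∑ i, φ (x + z - w i) ≤
        ∑ i, φ (x - w i) + inner ℝ (∑ i, v i) z + n * η⁻¹ * ‖z‖ ^ 2 := by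
      have h4 : ∑ i, φ (x + z - w i) ≤
          ∑ i, (φ (x - w i) + inner ℝ (v i) z + η⁻¹ * ‖z‖ ^ 2) := by
        refine Finset.sum_le_sum fun i _ => ?_
        rw [add_sub_right_comm]
        exact hquad i z
      refine h4.trans_eq ?_
      rw [Finset.sum_add_distrib, Finset.sum_add_distrib, sum_inner, Finset.sum_const,
        nsmul_eq_mul, Finset.card_univ, mul_assoc]
    rw [h2] at h1
    linarith

/-! ### Passage to the weak limit -/

theorem WeakTendsto.norm_le {u : ℕ → X} {v : X} {C : ℝ} (h : WeakTendsto u v)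
    (hu : ∀ k, ‖u k‖ ≤ C) : ‖v‖ ≤ C := by
  rcases eq_or_ne v 0 with rfl | hv
  · simpa using (norm_nonneg _).trans (hu 0)
  have h1 : inner ℝ v v ≤ C * ‖v‖ := le_of_tendsto' (h v) fun k =>
    (real_inner_le_norm _ _).trans (mul_le_mul_of_nonneg_right (hu k) (norm_nonneg v))
  rw [real_inner_self_eq_norm_mul_norm] at h1
  exact le_of_mul_le_mul_right h1 (norm_pos_iff.2 hv)

/-- The pairing of a bounded weakly convergent sequence with a convergent one converges. -/
theorem WeakTendsto.inner_of_tendsto {u p : ℕ → X} {v q : X} {C : ℝ} (h : WeakTendsto u v)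
    (hu : ∀ k, ‖u k‖ ≤ C) (hp : Tendsto p atTop (𝓝 q)) :
    Tendsto (fun k => inner ℝ (u k) (p k)) atTop (𝓝 (inner ℝ v q)) := by
  have h1 : Tendsto (fun k => inner ℝ (u k) (p k - q)) atTop (𝓝 0) := by
    have h2 : Tendsto (fun k => C * ‖p k - q‖) atTop (𝓝 0) := by
      simpa using (tendsto_iff_norm_sub_tendsto_zero.1 hp).const_mul C
    exact squeeze_zero_norm (fun k => (norm_inner_le_norm _ _).trans
      (mul_le_mul_of_nonneg_right (hu k) (norm_nonneg _))) h2
  simpa [inner_sub_right] using (h q).add h1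

/-- At a local minimizer of a sum of distances at which all projections are nonempty, zero is a
sum of elements of the sets `optSet`. -/
theorem zero_mem_sum_optSet [CompleteSpace X] {ι : Type*} [Fintype ι] {Ω : ι → Set X}
    (hcl : ∀ i, IsClosed (Ω i)) {xbar : X}
    (hmin : IsLocalMin (fun x : X => ∑ i, infDist x (Ω i)) xbar)
    (hproj : ∀ i, (proj xbar (Ω i)).Nonempty) :
    (0 : X) ∈ ∑ i, optSet (closedBall (0 : X) 1) (Ω i) xbar := by
  choose a ha using hproj
  obtain ⟨r, hr, hball⟩ := nhds_basis_closedBall.eventually_iff.1 hmin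
  have hmin' : ∀ x ∈ closedBall xbar r, ∀ w : ι → X, (∀ i, w i ∈ Ω i) →
      ∑ i, ‖xbar - a i‖ ≤ ∑ i, ‖x - w i‖ := by
    intro x hx w hw
    calc ∑ i, ‖xbar - a i‖ = ∑ i, infDist xbar (Ω i) :=
          Finset.sum_congr rfl fun i _ => (ha i).2
      _ ≤ ∑ i, infDist x (Ω i) := hball hx
      _ ≤ ∑ i, ‖x - w i‖ := Finset.sum_le_sum fun i _ => by
          rw [← dist_eq_norm]
          exact infDist_le_dist_of_mem (hw i)
  obtain ⟨ε, -, hε, hεlim⟩ := exists_seq_strictAnti_tendsto' (lt_min hr one_pos)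
  have hstep := fun k => exists_epsNormal_of_isLocalMin hcl (fun i => (ha i).1) hmin' (hε k).1
    ((hε k).2.trans_le (min_le_left _ _)) ((hε k).2.le.trans (min_le_right _ _))
  choose x w v hx hw hv hv1 hvin hvsum using hstep
  have hxlim : Tendsto x atTop (𝓝 xbar) :=
    tendsto_iff_norm_sub_tendsto_zero.2 (squeeze_zero (fun _ => norm_nonneg _) hx hεlim)
  have hwlim : ∀ i, Tendsto (fun k => w k i) atTop (𝓝 (a i)) := fun i =>
    tendsto_iff_norm_sub_tendsto_zero.2
      (squeeze_zero (fun _ => norm_nonneg _) (fun k => hw k i) hεlim)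
  obtain ⟨V, s, hs, hV⟩ := exists_weakTendsto_subseq_pi v hv1
  have hslim := hs.tendsto_atTop
  have hsum : ∑ i, V i = 0 := by
    have h1 : WeakTendsto (fun k => ∑ i, v (s k) i) (∑ i, V i) := by
      intro z
      simp only [sum_inner]
      exact tendsto_finsetSum _ fun i _ => hV i z
    have h2 : Tendsto (fun k => ∑ i, v (s k) i) atTop (𝓝 0) :=
      squeeze_zero_norm (fun k => hvsum (s k)) (hεlim.comp hslim)
    refine ext_inner_right ℝ fun z => ?_
    exact tendsto_nhds_unique (h1 z) (h2.inner tendsto_const_nhds)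
  rw [Set.mem_finsetSum]
  refine ⟨V, fun {i} _ => ?_, hsum⟩
  rw [mem_optSet_closedUnitBall ⟨a i, (ha i).1⟩]
  have hVnorm : ‖V i‖ ≤ 1 := (hV i).norm_le fun k => hv1 (s k) i
  refine ⟨a i, ha i, hVnorm, le_antisymm ?_ ?_, ε ∘ s, fun k => w (s k) i, fun k => v (s k) i,
    fun k => (hε _).1.le, hεlim.comp hslim, (hwlim i).comp hslim, hV i, fun k => hv (s k) i⟩
  · refine (real_inner_le_norm _ _).trans ?_
    exact mul_le_of_le_one_left (norm_nonneg _) hVnorm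
  -- Norm convergence of `x - w i` lets the pairing with the weakly convergent `v i` pass to the
  -- limit, so no norm is lost when `xbar ≠ a i`.
  · have hd : Tendsto (fun k => x (s k) - w (s k) i) atTop (𝓝 (xbar - a i)) :=
      (hxlim.sub (hwlim i)).comp hslim
    have hl : Tendsto (fun k => ‖x (s k) - w (s k) i‖ - ε (s k)) atTop (𝓝 ‖xbar - a i‖) := by
      simpa using hd.norm.sub (hεlim.comp hslim)
    exact le_of_tendsto_of_tendsto' hl
      ((hV i).inner_of_tendsto (fun k => hv1 (s k) i) hd) fun k => hvin (s k) i

end FermatTorricelli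

theorem theorem4p3 {X : Type*} [NormedAddCommGroup X] [InnerProductSpace ℝ X] [CompleteSpace X]
    (n : ℕ) (Ω : Fin n → Set X) (hne : ∀ i, (Ω i).Nonempty) (hcl : ∀ i, IsClosed (Ω i))
    (xbar : X) (hmin : IsLocalMin (fun x : X => ∑ i, Metric.infDist x (Ω i)) xbar)
    (hwp : ∀ i, xbar ∉ Ω i → FermatTorricelli.WellPosedDist (Ω i) xbar) :
    (0 : X) ∈ ∑ i, FermatTorricelli.optSet (Metric.closedBall (0 : X) 1) (Ω i) xbar ∧
    ∀ i,
      (xbar ∉ Ω i →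
        FermatTorricelli.optSet (Metric.closedBall (0 : X) 1) (Ω i) xbar =
          (fun w : X => (Metric.infDist xbar (Ω i))⁻¹ • (xbar - w)) ''
            FermatTorricelli.proj xbar (Ω i)) ∧
      (xbar ∈ Ω i →
        FermatTorricelli.optSet (Metric.closedBall (0 : X) 1) (Ω i) xbar =
          FermatTorricelli.normalCone xbar (Ω i) ∩ Metric.closedBall (0 : X) 1) := by
  refine ⟨FermatTorricelli.zero_mem_sum_optSet hcl hmin fun i => ?_, fun i =>
    ⟨FermatTorricelli.optSet_closedUnitBall_of_notMem (hne i) (hcl i),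
      FermatTorricelli.optSet_closedUnitBall_of_mem⟩⟩
  by_cases hi : xbar ∈ Ω i
  · exact ⟨xbar, hi, by simp [infDist_zero_of_mem hi]⟩
  -- The constant sequence `xbar` already yields a projection.
  · obtain ⟨w, hw, -⟩ := hwp i hi (fun _ => xbar) tendsto_const_nhds tendsto_const_nhds
    exact ⟨w 0, hw 0⟩
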